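/- Let $p$ be a prime and let $G$ be an extraspecial $p$-group, that is, a finite $p$-group whose center, derived subgroup and Frattini subgroup coincide and have order $p$: $Z(G)=G'=\Phi(G)$ and $|Z(G)|=p$. Then there exists an automorphism $\varphi$ of $G$ such that the set $$[G,\varphi]=\{\,g^{-1}\varphi(g) : g\in G\,\}$$ is not a subgroup of $G$. -/

import Mathlib

/-- The twisted conjugacy class of the unit element with respect to an endomorphism `φ` of `G`:
the set `[G, φ] = {g⁻¹ * φ g | g ∈ G}`. It is only a subset of `G`, not the subgroup that it
generates. -/
def twistedClassOne {G : Type*} [Group G] (φ : G →* G) : Set G :=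
  {x : G | ∃ g : G, x = g⁻¹ * φ g}

/-- Extraspecial `p`-groups: finite `p`-groups whose centre, derived subgroup and Frattini subgroup
coincide and have order `p`. -/
structure IsExtraspecial (p : ℕ) (G : Type*) [Group G] : Prop where
  finite : Finite G
  isPGroup : IsPGroup p G
  commutator_eq_center : commutator G = Subgroup.center G
  frattini_eq_center : frattini G = Subgroup.center G
  card_center : Nat.card (Subgroup.center G) = p

/-! Fix a noncentral `b`, some `a` not commuting with it, and the central `w ≠ 1` with `b * a = a *
b * w`. Since `w` generates the centre, `b * h = h * b * w ^ μ h` defines a homomorphism `μ` modulo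
`p`. Put `s i = b ^ i * w ^ i.choose 2`; then `φ g = g * s (μ g)` is an automorphism, provided `s p
= 1`, which `exists_noncentral_pow_mul_pow_choose_two` secures by the choice of `b`. The values of
`s` form `[G, φ]`. This set contains `b = s 1` but not `b ^ 2`, because `s 2 = b ^ 2 * w`. -/

section ClassTwo

variable {G : Type*} [Group G]

/-- If `h * g = g * h * w` with `w` central, then `(g * h) ^ n` is given by the collection
formula. -/
lemma mul_pow_of_mul_eq_mul_central {g h w : G} (hw : w ∈ Subgroup.center G)
    (hgh : h * g = g * h * w) (n : ℕ) :
    (g * h) ^ n = g ^ n * h ^ n * w ^ n.choose 2 := by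
  have hc : ∀ x : G, x * w = w * x := fun x => (Subgroup.mem_center_iff.mp hw x)
  have hpow : ∀ (n : ℕ) (x : G), x * w ^ n = w ^ n * x := fun n x =>
    ((show Commute x w from hc x).pow_right n).eq
  have key : ∀ n : ℕ, h ^ n * g = g * h ^ n * w ^ n := by
    intro n
    induction n with
    | zero => simp
    | succ n ih =>
      calc h ^ (n + 1) * g = h ^ n * (h * g) := by rw [pow_succ, mul_assoc]
        _ = (h ^ n * g) * h * w := by rw [hgh]; simp only [mul_assoc]
        _ = g * h ^ n * (w ^ n * h) * w := by rw [ih]; simp only [mul_assoc]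
        _ = g * h ^ (n + 1) * w ^ (n + 1) := by
          rw [← hpow n h, pow_succ h, pow_succ w]; simp only [mul_assoc]
  induction n with
  | zero => simp
  | succ n ih =>
    have hch : (n + 1).choose 2 = n + n.choose 2 := by
      rw [Nat.choose_succ_succ' n 1, Nat.choose_one_right]
    calc (g * h) ^ (n + 1) = g ^ n * h ^ n * (w ^ n.choose 2 * (g * h)) := by
          rw [pow_succ, ih]; simp only [mul_assoc]
      _ = g ^ n * (h ^ n * g) * h * w ^ n.choose 2 := by
          rw [← hpow]; simp only [mul_assoc]
      _ = g ^ n * g * h ^ n * (w ^ n * h) * w ^ n.choose 2 := by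
          rw [key]; simp only [mul_assoc]
      _ = g ^ (n + 1) * h ^ (n + 1) * w ^ (n + 1).choose 2 := by
          rw [← hpow n h, hch, pow_succ g, pow_succ h, pow_add]; simp only [mul_assoc]

end ClassTwo

namespace IsExtraspecial

variable {p : ℕ} {G : Type*} [Group G]

open scoped commutatorElement in
lemma exists_mul_eq_mul_central (hG : IsExtraspecial p G) (g h : G) :
    ∃ w ∈ Subgroup.center G, h * g = g * h * w := by
  refine ⟨⁅h⁻¹, g⁻¹⁆, ?_, by simp [commutatorElement_def, mul_assoc]⟩
  rw [← hG.commutator_eq_center]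
  exact Subgroup.commutator_mem_commutator (Subgroup.mem_top _) (Subgroup.mem_top _)

lemma pow_prime_of_mem_center (hG : IsExtraspecial p G) {z : G} (hz : z ∈ Subgroup.center G) :
    z ^ p = 1 := by
  have h : (⟨z, hz⟩ : Subgroup.center G) ^ p = 1 := by
    rw [← hG.card_center]; exact pow_card_eq_one'
  simpa using congrArg Subtype.val h

lemma exists_pow_eq_of_mem_center (hG : IsExtraspecial p G) (hp : p.Prime) {w z : G}
    (hw : w ∈ Subgroup.center G) (hw1 : w ≠ 1) (hz : z ∈ Subgroup.center G) :
    ∃ n : ℕ, z = w ^ n := by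
  have := Fact.mk hp
  have hmem : (⟨z, hz⟩ : Subgroup.center G) ∈ Submonoid.powers (⟨w, hw⟩ : Subgroup.center G) :=
    mem_powers_of_prime_card hG.card_center (fun h => hw1 (congrArg Subtype.val h))
  obtain ⟨n, hn⟩ := hmem
  exact ⟨n, by simpa using (congrArg Subtype.val hn).symm⟩

lemma pow_prime_mem_center (hG : IsExtraspecial p G) (g : G) : g ^ p ∈ Subgroup.center G := by
  rw [Subgroup.mem_center_iff]
  intro h
  obtain ⟨w, hw, hgh⟩ := hG.exists_mul_eq_mul_central g h
  have hc : Commute g w := Subgroup.mem_center_iff.mp hw g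
  have hconj : h * g * h⁻¹ = g * w := by
    rw [hgh, mul_assoc g h w, Subgroup.mem_center_iff.mp hw h]; simp [mul_assoc]
  have : h * g ^ p * h⁻¹ = g ^ p := by
    rw [← conj_pow, hconj, hc.mul_pow, hG.pow_prime_of_mem_center hw, mul_one]
  exact mul_inv_eq_iff_eq_mul.mp this

lemma exists_not_commute (hG : IsExtraspecial p G) (hp : p.Prime) :
    ∃ x y : G, ¬ Commute x y := by
  by_contra! hcomm
  have hbot : commutator G = ⊥ := by
    rw [commutator_def, Subgroup.commutator_eq_bot_iff_le_centralizer]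
    intro x _
    rw [Subgroup.mem_centralizer_iff]
    exact fun y _ => hcomm y x
  have hcard := hG.card_center
  rw [← hG.commutator_eq_center, hbot, Subgroup.card_bot] at hcard
  exact hp.one_lt.ne hcard

/-- There is a noncentral element of order `p` if `p` is odd, and of order `4` if `p = 2`. -/
lemma exists_noncentral_pow_mul_pow_choose_two (hG : IsExtraspecial p G) (hp : p.Prime) :
    ∃ b : G, b ∉ Subgroup.center G ∧
      ∀ w ∈ Subgroup.center G, w ≠ 1 → b ^ p * w ^ p.choose 2 = 1 := by
  obtain ⟨x, y, hxy⟩ := hG.exists_not_commute hp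
  rcases hp.eq_two_or_odd' with rfl | hodd
  · have hb : ∃ b : G, b ^ 2 ≠ 1 := by
      by_contra! h
      have hinv : ∀ g : G, g⁻¹ = g := fun g =>
        inv_eq_of_mul_eq_one_left (by rw [← sq]; exact h g)
      apply hxy
      calc x * y = (x * y)⁻¹ := (hinv _).symm
        _ = y * x := by rw [mul_inv_rev, hinv, hinv]
    obtain ⟨b, hb⟩ := hb
    refine ⟨b, fun h => hb (hG.pow_prime_of_mem_center h), fun w hw hw1 => ?_⟩
    -- The centre has order 2, so `w = b ^ 2` and the product is `b ^ 4 = 1`.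
    obtain ⟨n, hn⟩ := hG.exists_pow_eq_of_mem_center hp (hG.pow_prime_mem_center b) hb hw
    have hb4 := hG.pow_prime_of_mem_center (hG.pow_prime_mem_center b)
    rcases Nat.even_or_odd' n with ⟨k, rfl | rfl⟩
    · rw [pow_mul, hb4, one_pow] at hn
      exact absurd hn hw1
    · rw [pow_succ, pow_mul, hb4, one_pow, one_mul] at hn
      rw [hn, Nat.choose_self, pow_one, ← sq, hb4]
  · have hdvd : p ∣ p.choose 2 :=
      hp.dvd_choose_self two_ne_zero
        (lt_of_le_of_ne hp.two_le fun h => by rw [← h] at hodd; exact absurd hodd (by decide))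
    have hpow : ∀ w ∈ Subgroup.center G, w ^ p.choose 2 = 1 := by
      intro w hw
      obtain ⟨k, hk⟩ := hdvd
      rw [hk, pow_mul, hG.pow_prime_of_mem_center hw, one_pow]
    suffices h : ∃ b : G, b ∉ Subgroup.center G ∧ b ^ p = 1 by
      obtain ⟨b, hb, hbp⟩ := h
      exact ⟨b, hb, fun w hw _ => by rw [hbp, hpow w hw, one_mul]⟩
    by_cases hx : x ^ p = 1
    · exact ⟨x, fun h => hxy (Subgroup.mem_center_iff.mp h y).symm, hx⟩
    -- Now `x ^ p` generates the centre, so a power of `x` can cancel the `p`-th power of `y`: for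
    -- odd `p` the collection formula gives `(x ^ n * y) ^ p = x ^ (n * p) * y ^ p`.
    obtain ⟨n, hn⟩ := hG.exists_pow_eq_of_mem_center hp (hG.pow_prime_mem_center x) hx
      (inv_mem (hG.pow_prime_mem_center y))
    refine ⟨x ^ n * y, fun h => hxy ?_, ?_⟩
    · have h1 : Commute x (x ^ n * y) := Subgroup.mem_center_iff.mp h x
      have h2 : Commute x ((x ^ n)⁻¹ * (x ^ n * y)) :=
        ((Commute.refl x).pow_right n).inv_right.mul_right h1
      rwa [inv_mul_cancel_left] at h2
    · obtain ⟨w, hw, hgh⟩ := hG.exists_mul_eq_mul_central (x ^ n) y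
      rw [mul_pow_of_mul_eq_mul_central hw hgh, hpow w hw, mul_one, ← pow_mul, mul_comm n p,
        pow_mul, ← hn, inv_mul_cancel]

end IsExtraspecial

theorem proposition3p2 (p : ℕ) (hp : p.Prime) (G : Type*) [Group G]
    (hG : IsExtraspecial p G) :
    ∃ φ : MulAut G, ¬ ∃ H : Subgroup G, (H : Set G) = twistedClassOne (φ : G ≃* G).toMonoidHom := by
  have := hG.finite
  obtain ⟨b, hb, hbp⟩ := hG.exists_noncentral_pow_mul_pow_choose_two hp
  obtain ⟨a, hab⟩ : ∃ a : G, a * b ≠ b * a := by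
    by_contra! h
    exact hb (Subgroup.mem_center_iff.mpr h)
  obtain ⟨w, hw, hba⟩ := hG.exists_mul_eq_mul_central a b
  have hw1 : w ≠ 1 := by
    rintro rfl
    exact hab (by rw [hba, mul_one])
  have hwp := hG.pow_prime_of_mem_center hw
  have hord : orderOf w = p := haveI := Fact.mk hp; orderOf_eq_prime hwp hw1
  have hpowmod : ∀ {i j : ℕ}, w ^ i = w ^ j ↔ i ≡ j [MOD p] := by
    intro i j; rw [pow_eq_pow_iff_modEq, hord]
  have hwc : ∀ x : G, Commute x w := fun x => Subgroup.mem_center_iff.mp hw x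
  -- `μ h` is the exponent with which `h` acts on `b` by conjugation
  have hμ : ∀ h : G, ∃ n : ℕ, b * h = h * b * w ^ n := by
    intro h
    obtain ⟨v, hv, hbh⟩ := hG.exists_mul_eq_mul_central h b
    obtain ⟨n, rfl⟩ := hG.exists_pow_eq_of_mem_center hp hw hw1 hv
    exact ⟨n, hbh⟩
  choose μ hμ using hμ
  have hμ_iff : ∀ {h : G} {n : ℕ}, b * h = h * b * w ^ n → μ h ≡ n [MOD p] := by
    intro h n hn
    rw [hμ h] at hn
    exact hpowmod.mp (mul_left_cancel hn)
  have hμ_mul : ∀ g h : G, μ (g * h) ≡ μ g + μ h [MOD p] := by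
    intro g h
    apply hμ_iff
    calc b * (g * h) = g * b * (w ^ μ g * h) := by rw [← mul_assoc, hμ g, mul_assoc]
      _ = g * (b * h) * w ^ μ g := by
        rw [← ((hwc h).pow_right (μ g)).eq]; simp only [mul_assoc]
      _ = g * h * b * w ^ (μ g + μ h) := by
        rw [hμ h, add_comm, pow_add]; simp only [mul_assoc]
  have hμ_pow : ∀ (g : G) (i : ℕ), b ^ i * g = g * b ^ i * w ^ (i * μ g) := by
    intro g i
    have h1 : g⁻¹ * b * g⁻¹⁻¹ = b * w ^ μ g := by
      rw [inv_inv, mul_assoc, hμ g]; simp [mul_assoc]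
    have h2 : g⁻¹ * b ^ i * g⁻¹⁻¹ = b ^ i * w ^ (i * μ g) := by
      rw [← conj_pow, h1, ((hwc b).pow_right _).mul_pow, ← pow_mul, mul_comm (μ g)]
    rw [inv_inv] at h2
    rw [mul_assoc g, ← h2]; simp [mul_assoc]
  -- The binomial exponent produces the factor `w ^ (i * j)` in `s (i + j)`, exactly what moving `s
  -- i` past an `h` with `μ h = j` costs.
  let s : ℕ → G := fun i => b ^ i * w ^ i.choose 2
  have hs_add : ∀ i j : ℕ, s (i + j) = s i * w ^ (i * j) * s j := by
    intro i j
    have hch : (i + j).choose 2 = i.choose 2 + i * j + j.choose 2 := by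
      rw [Nat.add_choose_eq, Finset.Nat.antidiagonal_succ]
      simp [Finset.Nat.antidiagonal_succ]; ring
    have hc := ((hwc (b ^ j)).pow_right (i.choose 2 + i * j)).eq
    calc s (i + j) = b ^ i * (b ^ j * w ^ (i.choose 2 + i * j)) * w ^ j.choose 2 := by
          simp only [s]; rw [hch, pow_add b, pow_add w]; simp only [mul_assoc]
      _ = s i * w ^ (i * j) * s j := by
          rw [hc]; simp only [s, pow_add, mul_assoc]
  have hsp : s p = 1 := hbp w hw hw1
  have hs0 : s 0 = 1 := by simp [s]
  have hs_per : Function.Periodic s p := by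
    intro i
    rw [hs_add, hsp, mul_comm i p, pow_mul, hwp, one_pow, mul_one, mul_one]
  have hs_mod : ∀ {i j : ℕ}, i ≡ j [MOD p] → s i = s j := by
    intro i j hij
    rw [← hs_per.map_mod_nat i, ← hs_per.map_mod_nat j, hij]
  have hs_conj : ∀ (i : ℕ) (h : G), s i * h = h * s i * w ^ (i * μ h) := by
    intro i h
    have hc := ((hwc h).pow_right (i.choose 2)).eq
    calc s i * h = (b ^ i * h) * w ^ i.choose 2 := by
          simp only [s]; rw [mul_assoc, ← hc, mul_assoc]
      _ = h * s i * w ^ (i * μ h) := by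
          rw [hμ_pow]; simp only [s, mul_assoc]; rw [← pow_add, ← pow_add, add_comm]
  let φ₀ : G →* G := MonoidHom.mk' (fun g => g * s (μ g)) (by
    intro g h
    have hc := ((hwc (s (μ h))).pow_right (μ g * μ h)).eq
    calc g * h * s (μ (g * h)) = g * (h * s (μ g) * w ^ (μ g * μ h)) * s (μ h) := by
          rw [hs_mod (hμ_mul g h), hs_add]; simp only [mul_assoc]
      _ = g * s (μ g) * (h * s (μ h)) := by
          rw [← hs_conj]; simp only [mul_assoc])
  have hφ₀ : ∀ g, φ₀ g = g * s (μ g) := fun g => rfl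
  have hinj : Function.Injective φ₀ := by
    rw [injective_iff_map_eq_one]
    intro g hg
    rw [hφ₀] at hg
    -- A kernel element is the inverse of some `s i`, so it commutes with `b`; hence `μ g ≡ 0` and
    -- `s (μ g) = 1`.
    have hbs : Commute b (s (μ g)) :=
      ((Commute.refl b).pow_right _).mul_right ((hwc b).pow_right _)
    have hbg : Commute b g := by
      rw [eq_inv_of_mul_eq_one_left hg]; exact hbs.inv_right
    have h0 : μ g ≡ 0 [MOD p] := hμ_iff (by rw [pow_zero, mul_one]; exact hbg)
    rwa [hs_mod h0, hs0, mul_one] at hg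
  let φ : MulAut G := MulEquiv.ofBijective φ₀ (Finite.injective_iff_bijective.mp hinj)
  have hφ : ∀ g, g⁻¹ * φ g = s (μ g) := fun g => inv_mul_cancel_left g (s (μ g))
  refine ⟨φ, ?_⟩
  rintro ⟨H, hH⟩
  have hmem : ∀ x, x ∈ H ↔ ∃ g, x = s (μ g) := by
    intro x
    rw [← SetLike.mem_coe, hH]
    exact exists_congr fun g => by rw [← hφ g]; rfl
  have hμa : μ a ≡ 1 [MOD p] := hμ_iff (by rw [pow_one]; exact hba)
  have hbH : b ∈ H := (hmem b).mpr ⟨a, by rw [hs_mod hμa]; simp [s]⟩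
  obtain ⟨g, hg⟩ := (hmem _).mp (pow_mem hbH 2)
  -- comparing the actions of `b ^ 2` and `s (μ g)` on `a` gives `μ g ≡ 2`
  have h2 := hs_conj (μ g) a
  rw [← hg, hμ_pow] at h2
  have h3 : 2 * μ a ≡ μ g * μ a [MOD p] := hpowmod.mp (mul_left_cancel h2)
  have h4 : 2 ≡ μ g [MOD p] := by
    have h5 := ((hμa.mul_left 2).symm.trans h3).trans (hμa.mul_left (μ g))
    rwa [mul_one, mul_one] at h5
  -- Now `b ^ 2 = s 2 = b ^ 2 * w`, forcing `w = 1`.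
  rw [← hs_mod h4] at hg
  apply hw1
  simpa [s] using hg
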